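/- Let $p \ge 1$ be real. A \emph{barycentric algebra} is a set $A$ with operations $+_r : A^2 \to A$ ($r \in [0,1]$) satisfying $x +_1 y = x$, $x +_r x = x$, $x +_r y = y +_{1-r} x$, and $(x +_s y) +_r z = x +_{sr} (y +_{(r-sr)/(1-sr)} z)$ whenever $r,s<1$; homomorphisms of barycentric algebras are called affine. An \emph{extended metric Wasserstein algebra of order $p$} is an extended metric space $(A,d)$ (distances in $[0,\infty]$) that is also a barycentric algebra whose operations $+_r : A^2\to A$ are nonexpansive for the maximum distance on $A^2$ and satisfy $$d(x +_r y,\, x' +_r y')^p \le r\, d(x,x')^p + (1-r)\, d(y,y')^p$$ for all $r\in[0,1]$ and $x,x',y,y' \in A$ (with $0\cdot\infty=0$). It is \emph{complete} if $(A,d)$ is. For a metric space $X$, let $P_p(X)$ be the set of Radon Borel probability measures $\mu$ on $X$ (every Borel set $B$ satisfies $\mu(B)=\sup\{\mu(C) : C\subseteq B \text{ compact}\}$) with $\int d(x_0,x)^p\,d\mu(x)<\infty$ for some $x_0\in X$, equipped with the Wasserstein distance $$W_p(\mu,\nu)=\Big(\inf_\gamma \int d(x,y)^p\,d\gamma(x,y)\Big)^{1/p},$$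 where $\gamma$ ranges over the Borel probability measures on $X\times X$ with marginals $\mu$ and $\nu$, and with the operations $\mu +_r \nu = r\mu+(1-r)\nu$. \textbf{Theorem.} For any complete metric space $X$, $P_p(X)$ is the free complete extended metric Wasserstein algebra of order $p$ over $X$, with universal arrow the Dirac delta function $\delta : X \to P_p(X)$. That is, $W_p$ is an extended metric on $P_p(X)$, with which $P_p(X)$ is a complete extended metric Wasserstein algebra of order $p$; $\delta$ is nonexpansive; and for every complete extended metric Wasserstein algebra $B$ of order $p$ and every nonexpansive map $f : X \to B$ there is a unique nonexpansive affine map $h : P_p(X) \to B$ with $h\circ\delta = f$. -/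

import Mathlib

open MeasureTheory Set
open scoped ENNReal unitInterval

universe u v

/-! ### Barycentric algebras and extended metric Wasserstein algebras -/

/-- `op r x y` is the barycentric operation `x +_r y`, for `r ∈ [0,1]`. -/
structure IsBarycentricAlgebra {A : Type*} (op : I → A → A → A) : Prop where
  one_left : ∀ x y, op 1 x y = x
  idem : ∀ r x, op r x x = x
  skew_comm : ∀ r x y, op r x y = op (unitInterval.symm r) y x
  /-- `(x +_s y) +_r z = x +_{sr} (y +_q z)` with `q = (r - sr) / (1 - sr)`, for `r, s < 1`. -/
  skew_assoc : ∀ s r q : I, r < 1 → s < 1 →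
    (q : ℝ) = ((r : ℝ) - (s : ℝ) * (r : ℝ)) / (1 - (s : ℝ) * (r : ℝ)) →
    ∀ x y z, op r (op s x y) z = op (s * r) x (op q y z)

/-- Wasserstein (barycentric) algebra of order `p` over an extended metric space.  The product
`A × A` carries the maximum distance. -/
structure IsWassersteinAlgebra (p : ℝ) {A : Type*} [EMetricSpace A] (op : I → A → A → A) : Prop
    extends IsBarycentricAlgebra op where
  nonexpansive : ∀ r, LipschitzWith 1 (fun z : A × A => op r z.1 z.2)
  edist_op_rpow_le : ∀ (r : I) (x x' y y' : A),
    edist (op r x y) (op r x' y') ^ p ≤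
      ENNReal.ofReal (r : ℝ) * edist x x' ^ p + ENNReal.ofReal (1 - (r : ℝ)) * edist y y' ^ p

/-- Homomorphisms of Wasserstein algebras: nonexpansive affine maps. -/
structure IsWassersteinHom {A B : Type*} [EMetricSpace A] [EMetricSpace B]
    (opA : I → A → A → A) (opB : I → B → B → B) (h : A → B) : Prop where
  nonexpansive : LipschitzWith 1 h
  map_op : ∀ r x y, h (opA r x y) = opB r (h x) (h y)

/-- The algebra `(A, op)` is the free complete extended metric Wasserstein algebra of order `p`
over `X`, with universal arrow `η : X → A`; the universal property is tested against all
complete extended metric Wasserstein algebras with carrier in the universe `c`. -/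
structure IsFreeCompleteWassersteinAlgebra.{a, b, c} (p : ℝ) {X : Type a} [EMetricSpace X]
    {A : Type b} [EMetricSpace A] (op : I → A → A → A) (η : X → A) : Prop where
  complete : CompleteSpace A
  isWassersteinAlgebra : IsWassersteinAlgebra p op
  nonexpansive : LipschitzWith 1 η
  existsUnique_extension : ∀ (B : Type c) [EMetricSpace B] [CompleteSpace B]
    (opB : I → B → B → B), IsWassersteinAlgebra p opB →
    ∀ f : X → B, LipschitzWith 1 f →
      ∃! h : A → B, IsWassersteinHom op opB h ∧ ∀ x, h (η x) = f x

/-! ### Wasserstein spaces -/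

/-- `γ` is a coupling of `μ` and `ν`.  It is a Borel probability measure on `X × X`; the Borel
σ-algebra of `X × X` can be strictly larger than the product σ-algebra when `X` is not
separable, so it is named explicitly. -/
structure IsCoupling {X : Type*} [TopologicalSpace X] [MeasurableSpace X] (μ ν : Measure X)
    (γ : @Measure (X × X) (borel (X × X))) : Prop where
  isProbabilityMeasure : @IsProbabilityMeasure (X × X) (borel (X × X)) γ
  map_fst : @Measure.map (X × X) X (borel (X × X)) _ Prod.fst γ = μ
  map_snd : @Measure.map (X × X) X (borel (X × X)) _ Prod.snd γ = ν

/-- The Wasserstein distance of order `p`. -/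
noncomputable def wassersteinDist (p : ℝ) {X : Type*} [MetricSpace X] [MeasurableSpace X]
    (μ ν : Measure X) : ℝ≥0∞ :=
  (⨅ (γ : @Measure (X × X) (borel (X × X))) (_ : IsCoupling μ ν γ),
    @lintegral (X × X) (borel (X × X)) γ (fun z => edist z.1 z.2 ^ p)) ^ (1 / p)

/-- Finite moment of order `p`. -/
def HasFiniteMoment (p : ℝ) {X : Type*} [MetricSpace X] [MeasurableSpace X]
    (μ : Measure X) : Prop :=
  ∃ x₀ : X, ∫⁻ x, edist x₀ x ^ p ∂μ < ∞

/-- The set `P_p(X)` of Radon probability measures on `X` with finite moment of order `p`.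
(`Measure.InnerRegular` says that every measurable set is compact inner regular.) -/
structure WassersteinSpace (p : ℝ) (X : Type*) [MetricSpace X] [MeasurableSpace X] where
  measure : Measure X
  isProbabilityMeasure : IsProbabilityMeasure measure
  isRadon : measure.InnerRegular
  hasFiniteMoment : HasFiniteMoment p measure

section

variable {X : Type*} [MetricSpace X] [MeasurableSpace X] {p : ℝ}

theorem HasFiniteMoment.basepoint (hp : 1 ≤ p) {μ : Measure X} [IsProbabilityMeasure μ]
    (h : HasFiniteMoment p μ) (x₁ : X) : ∫⁻ x, edist x₁ x ^ p ∂μ < ∞ := by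
  obtain ⟨x₀, h₀⟩ := h
  have hp0 : 0 ≤ p := by linarith
  refine lt_of_le_of_lt (lintegral_mono (g := fun x => (edist x₁ x₀ + edist x₀ x) ^ p)
    fun x => ENNReal.rpow_le_rpow (edist_triangle _ _ _) hp0) ?_
  refine ENNReal.lintegral_rpow_add_lt_top_of_lintegral_rpow_lt_top
    (f := fun _ => edist x₁ x₀) (g := fun x => edist x₀ x) aemeasurable_const ?_ h₀ hp
  simpa using ENNReal.rpow_lt_top_of_nonneg hp0 (edist_ne_top x₁ x₀)

variable [BorelSpace X]

/-- The Dirac delta `δ : X → P_p(X)`. -/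
noncomputable def WassersteinSpace.dirac (hp : 1 ≤ p) (x : X) : WassersteinSpace p X where
  measure := Measure.dirac x
  isProbabilityMeasure := inferInstance
  isRadon := by
    refine ⟨fun A hA r hr => ?_⟩
    by_cases hx : x ∈ A
    · refine ⟨{x}, by simpa using hx, isCompact_singleton, ?_⟩
      refine lt_of_lt_of_le hr ?_
      rw [Measure.dirac_apply_of_mem hx, Measure.dirac_apply_of_mem (mem_singleton x)]
    · rw [Measure.dirac_apply' x hA] at hr
      simp [hx] at hr
  hasFiniteMoment := ⟨x, by
    have hp0 : 0 < p := by linarith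
    simp [lintegral_dirac, ENNReal.zero_rpow_of_pos hp0]⟩

/-- The convex combination `(μ +_r ν)(B) = r μ(B) + (1 - r) ν(B)` on `P_p(X)`. -/
noncomputable def WassersteinSpace.convexComb (hp : 1 ≤ p) (r : I)
    (μ ν : WassersteinSpace p X) : WassersteinSpace p X where
  measure := ENNReal.ofReal (r : ℝ) • μ.measure + ENNReal.ofReal (1 - (r : ℝ)) • ν.measure
  isProbabilityMeasure := by
    have := μ.isProbabilityMeasure
    have := ν.isProbabilityMeasure
    refine ⟨?_⟩
    simp only [Measure.coe_add, Measure.coe_smul, Pi.add_apply, Pi.smul_apply, measure_univ,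
      smul_eq_mul, mul_one]
    rw [← ENNReal.ofReal_add r.2.1 (by linarith [r.2.2])]
    simp
  isRadon := by
    have := μ.isRadon
    have := ν.isRadon
    infer_instance
  hasFiniteMoment := by
    have := μ.isProbabilityMeasure
    have := ν.isProbabilityMeasure
    obtain ⟨x₀, h₀⟩ := μ.hasFiniteMoment
    have h₁ := ν.hasFiniteMoment.basepoint hp x₀
    refine ⟨x₀, ?_⟩
    rw [lintegral_add_measure, lintegral_smul_measure, lintegral_smul_measure]
    exact ENNReal.add_lt_top.2 ⟨ENNReal.mul_lt_top ENNReal.ofReal_lt_top h₀,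
      ENNReal.mul_lt_top ENNReal.ofReal_lt_top h₁⟩

end

/-!
Every barycentric algebra embeds in an `ℝ≥0`-module, its cone, so finite barycenters make sense and
commute with affine maps. A convex function satisfies Jensen's inequality, because its positively
homogeneous extension to the cone is subadditive. Applied to `d ^ p` on the square of a Wasserstein
algebra, and combined with the fact that a coupling of finitely supported measures is finitely
supported, Jensen's inequality shows that taking barycenters of `f` is nonexpansive on finitely
supported measures. These are dense in `P_p(X)`, so this map has a unique continuous extension.

For completeness, near-optimal couplings of consecutive terms of a fast Cauchy sequence are glued
by disintegration, which is possible because a sequence of Radon measures lives on a common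
separable closed set. The glued Markov chain is a random sequence that converges in `L^p`, and the
law of its limit is the limit of the measures. The triangle inequality is the same gluing for three
terms. Measures at distance zero agree because a power of `W_p` dominates a power of the
Lévy-Prokhorov distance.
-/

open Convexity unitInterval
open scoped NNReal

/-! ### Barycenters -/

/-- Homomorphisms of barycentric algebras. -/
def IsAffine {A B : Type*} (opA : I → A → A → A) (opB : I → B → B → B) (g : A → B) : Prop :=
  ∀ r x y, g (opA r x y) = opB r (g x) (g y)

/-- The barycentric operation `(r, x, y) ↦ r x + (1 - r) y` of a module over the nonnegative
reals. -/
noncomputable def moduleOp {M : Type*} [AddCommMonoid M] [Module ℝ≥0 M] (r : I) (x y : M) : M :=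
  toNNReal r • x + toNNReal (σ r) • y

/-- The coordinatewise barycentric operation of a product. -/
def prodOp {A B : Type*} (opA : I → A → A → A) (opB : I → B → B → B) (r : I) (x y : A × B) :
    A × B :=
  (opA r x.1 y.1, opB r x.2 y.2)

namespace IsBarycentricAlgebra

variable {A B M : Type*} {opA : I → A → A → A} {opB : I → B → B → B}
  [AddCommMonoid M] [Module ℝ≥0 M]

theorem zero_left (h : IsBarycentricAlgebra opA) (x y : A) : opA 0 x y = y := by
  rw [h.skew_comm, symm_zero, h.one_left]

theorem prod (hA : IsBarycentricAlgebra opA) (hB : IsBarycentricAlgebra opB) :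
    IsBarycentricAlgebra (prodOp opA opB) where
  one_left _ _ := Prod.ext (hA.one_left _ _) (hB.one_left _ _)
  idem r _ := Prod.ext (hA.idem r _) (hB.idem r _)
  skew_comm r _ _ := Prod.ext (hA.skew_comm r _ _) (hB.skew_comm r _ _)
  skew_assoc s r q hr hs hq _ _ _ :=
    Prod.ext (hA.skew_assoc s r q hr hs hq _ _ _) (hB.skew_assoc s r q hr hs hq _ _ _)

theorem of_injective {g : A → B} (hB : IsBarycentricAlgebra opB) (hg : Function.Injective g)
    (hgop : IsAffine opA opB g) : IsBarycentricAlgebra opA where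
  one_left x y := hg <| by rw [hgop, hB.one_left]
  idem r x := hg <| by rw [hgop, hB.idem]
  skew_comm r x y := hg <| by rw [hgop, hgop, hB.skew_comm]
  skew_assoc s r q hr hs hq x y z := hg <| by
    simp only [hgop _ _ _]
    exact hB.skew_assoc s r q hr hs hq _ _ _

protected theorem moduleOp : IsBarycentricAlgebra (moduleOp : I → M → M → M) where
  one_left x y := by simp [moduleOp]
  idem r x := by rw [moduleOp, ← add_smul, toNNReal_add_toNNReal_symm, one_smul]
  skew_comm r x y := by rw [moduleOp, moduleOp, symm_symm, add_comm]
  skew_assoc s r q _ hs hq x y z := by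
    have hsr : (s : ℝ) * r < 1 := mul_lt_one_of_nonneg_of_lt_one_left s.2.1 hs r.2.2
    have hq' : (q : ℝ) * (1 - s * r) = r - s * r := by
      rw [hq, div_mul_cancel₀ _ (sub_pos.2 hsr).ne']
    have hy : toNNReal r * toNNReal (σ s) = toNNReal (σ (s * r)) * toNNReal q := by
      ext
      simp only [NNReal.coe_mul, coe_toNNReal, coe_symm_eq, Set.Icc.coe_mul]
      linear_combination -hq'
    have hz : toNNReal (σ r) = toNNReal (σ (s * r)) * toNNReal (σ q) := by
      ext
      simp only [NNReal.coe_mul, coe_toNNReal, coe_symm_eq, Set.Icc.coe_mul]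
      linear_combination hq'
    have hx : toNNReal r * toNNReal s = toNNReal (s * r) := by
      ext
      simp [mul_comm]
    simp only [moduleOp, smul_add, smul_smul, add_assoc, hx, hy, hz]

end IsBarycentricAlgebra

/-- The proportion `s / (s + t)` of two weights. -/
noncomputable def weightRatio (s t : ℝ≥0) : I :=
  ⟨s / (s + t), by positivity, div_le_one_of_le₀ (by simp) (by positivity)⟩

theorem coe_weightRatio (s t : ℝ≥0) : (weightRatio s t : ℝ) = s / (s + t) := rfl

theorem weightRatio_lt_one (s : ℝ≥0) {t : ℝ≥0} (ht : 0 < t) : weightRatio s t < 1 := by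
  rw [← Subtype.coe_lt_coe, coe_weightRatio, Set.Icc.coe_one, div_lt_one (by positivity)]
  exact lt_add_of_pos_right _ ht

theorem symm_weightRatio {s t : ℝ≥0} (hs : 0 < s) : σ (weightRatio s t) = weightRatio t s := by
  ext
  rw [coe_symm_eq, coe_weightRatio, coe_weightRatio]
  field_simp
  ring

theorem weightRatio_mul_weightRatio {s : ℝ≥0} (hs : 0 < s) (t w : ℝ≥0) :
    weightRatio s t * weightRatio (s + t) w = weightRatio s (t + w) := by
  ext
  simp only [Set.Icc.coe_mul, coe_weightRatio, NNReal.coe_add]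
  field_simp
  ring

theorem weightRatio_mul_mul {c : ℝ≥0} (hc : 0 < c) (s t : ℝ≥0) :
    weightRatio (c * s) (c * t) = weightRatio s t := by
  ext
  rw [coe_weightRatio, coe_weightRatio, NNReal.coe_mul, NNReal.coe_mul, ← mul_add,
    mul_div_mul_left _ _ (NNReal.coe_pos.2 hc).ne']

theorem toNNReal_weightRatio (s t : ℝ≥0) : toNNReal (weightRatio s t) = s / (s + t) := by
  ext
  simp [coe_weightRatio]

/-- A point of a barycentric algebra together with a positive weight: a nonzero element of the
cone over the algebra. -/
@[ext] structure PosCone {A : Type*} {op : I → A → A → A} (h : IsBarycentricAlgebra op) where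
  weight : ℝ≥0
  pos : 0 < weight
  point : A

namespace PosCone

variable {A : Type*} {op : I → A → A → A} {h : IsBarycentricAlgebra op}

noncomputable instance : Add (PosCone h) where
  add a b := ⟨a.weight + b.weight, add_pos a.pos b.pos,
    op (weightRatio a.weight b.weight) a.point b.point⟩

theorem add_weight (a b : PosCone h) : (a + b).weight = a.weight + b.weight := rfl

theorem add_point (a b : PosCone h) :
    (a + b).point = op (weightRatio a.weight b.weight) a.point b.point := rfl

noncomputable instance : AddCommSemigroup (PosCone h) where
  add_assoc a b c := by
    ext1
    · simp only [add_weight, add_assoc]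
    have hq : (weightRatio b.weight c.weight : ℝ) =
        (weightRatio (a.weight + b.weight) c.weight - weightRatio a.weight b.weight *
          weightRatio (a.weight + b.weight) c.weight) / (1 - weightRatio a.weight b.weight *
          weightRatio (a.weight + b.weight) c.weight) := by
      rw [← Set.Icc.coe_mul, weightRatio_mul_weightRatio a.pos, ← coe_symm_eq,
        symm_weightRatio a.pos]
      have := b.pos
      simp only [coe_weightRatio, NNReal.coe_add]
      field_simp
      ring
    simp only [add_point, add_weight]
    rw [h.skew_assoc _ _ _ (weightRatio_lt_one _ c.pos) (weightRatio_lt_one _ b.pos) hq,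
      weightRatio_mul_weightRatio a.pos]
  add_comm a b := by
    ext1
    · simp only [add_weight, add_comm]
    · rw [add_point, h.skew_comm, symm_weightRatio a.pos, add_point]

end PosCone

theorem add_smul_moduleOp_weightRatio {M : Type*} [AddCommMonoid M] [Module ℝ≥0 M] {s t : ℝ≥0}
    (hs : 0 < s) (x y : M) : (s + t) • moduleOp (weightRatio s t) x y = s • x + t • y := by
  have hne : s + t ≠ 0 := (add_pos_of_pos_of_nonneg hs t.2).ne'
  rw [moduleOp, symm_weightRatio hs, toNNReal_weightRatio, toNNReal_weightRatio, smul_add,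
    smul_smul, smul_smul, add_comm t, mul_div_cancel₀ _ hne, mul_div_cancel₀ _ hne]

/-- The cone over a barycentric algebra: the `ℝ≥0`-module freely generated by it. -/
abbrev Cone {A : Type*} {op : I → A → A → A} (h : IsBarycentricAlgebra op) : Type _ :=
  WithZero (PosCone h)

namespace Cone

variable {A M : Type*} {op : I → A → A → A} {h : IsBarycentricAlgebra op}
  [AddCommMonoid M] [Module ℝ≥0 M]

noncomputable instance : SMul ℝ≥0 (Cone h) where
  smul c a := if hc : 0 < c then
    WithZero.recZeroCoe 0
      (fun a => ((⟨c * a.weight, mul_pos hc a.pos, a.point⟩ : PosCone h) : Cone h)) a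
    else 0

theorem smul_coe {c : ℝ≥0} (hc : 0 < c) (a : PosCone h) :
    c • (a : Cone h) = ((⟨c * a.weight, mul_pos hc a.pos, a.point⟩ : PosCone h) : Cone h) :=
  dif_pos hc

protected theorem zero_smul (a : Cone h) : (0 : ℝ≥0) • a = 0 := dif_neg (lt_irrefl _)

protected theorem smul_zero (c : ℝ≥0) : c • (0 : Cone h) = 0 := by
  rcases eq_zero_or_pos c with rfl | hc
  · exact Cone.zero_smul 0
  · exact dif_pos hc

noncomputable instance : Module ℝ≥0 (Cone h) where
  zero_smul := Cone.zero_smul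
  smul_zero := Cone.smul_zero
  one_smul a := by
    induction a using WithZero.recZeroCoe with
    | zero => exact Cone.smul_zero 1
    | coe a => simp only [smul_coe one_pos, one_mul]
  mul_smul c d a := by
    rcases eq_zero_or_pos c with rfl | hc
    · rw [zero_mul, Cone.zero_smul, Cone.zero_smul]
    rcases eq_zero_or_pos d with rfl | hd
    · rw [mul_zero, Cone.zero_smul, Cone.smul_zero]
    induction a using WithZero.recZeroCoe with
    | zero => simp only [Cone.smul_zero]
    | coe a => simp only [smul_coe hc, smul_coe hd, smul_coe (mul_pos hc hd), mul_assoc]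
  smul_add c a b := by
    rcases eq_zero_or_pos c with rfl | hc
    · simp only [Cone.zero_smul, add_zero]
    induction a using WithZero.recZeroCoe with
    | zero => simp only [Cone.smul_zero, zero_add]
    | coe a =>
      induction b using WithZero.recZeroCoe with
      | zero => simp only [Cone.smul_zero, add_zero]
      | coe b =>
        simp only [← WithZero.coe_add, smul_coe hc]
        congr 1
        ext1
        · exact mul_add ..
        · simp only [PosCone.add_point, weightRatio_mul_mul hc]
  add_smul c d a := by
    rcases eq_zero_or_pos c with rfl | hc
    · rw [zero_add, Cone.zero_smul, zero_add]
    rcases eq_zero_or_pos d with rfl | hd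
    · rw [add_zero, Cone.zero_smul, add_zero]
    induction a using WithZero.recZeroCoe with
    | zero => simp only [Cone.smul_zero, add_zero]
    | coe a =>
      simp only [smul_coe hc, smul_coe hd, smul_coe (add_pos hc hd), ← WithZero.coe_add]
      congr 1
      ext1
      · exact add_mul ..
      · exact (h.idem _ _).symm

/-- The inclusion of a barycentric algebra into its cone, as the points of weight one. -/
def of (h : IsBarycentricAlgebra op) (x : A) : Cone h := ((⟨1, one_pos, x⟩ : PosCone h) : Cone h)

theorem of_injective : Function.Injective (of h) := fun _ _ hxy =>
  congrArg PosCone.point (WithZero.coe_inj.1 hxy)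

theorem smul_of {c : ℝ≥0} (hc : 0 < c) (x : A) :
    c • of h x = ((⟨c, hc, x⟩ : PosCone h) : Cone h) := by
  simp only [of, smul_coe hc, mul_one]

theorem isAffine_of : IsAffine op moduleOp (of h) := by
  intro r x y
  rcases eq_or_ne r 0 with rfl | hr
  · simp [moduleOp, h.zero_left]
  rcases eq_or_ne r 1 with rfl | hr'
  · simp [moduleOp, h.one_left]
  have hr_pos : 0 < toNNReal r := unitInterval.pos_iff_ne_zero.2 hr
  have hsr_pos : 0 < toNNReal (σ r) := unitInterval.pos_iff_ne_zero.2 <| by simpa using hr'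
  have hratio : weightRatio (toNNReal r) (toNNReal (σ r)) = r := by
    ext
    rw [coe_weightRatio, ← NNReal.coe_add, toNNReal_add_toNNReal_symm]
    simp
  rw [moduleOp, smul_of hr_pos, smul_of hsr_pos, ← WithZero.coe_add, of]
  congr 1
  ext1
  · exact (toNNReal_add_toNNReal_symm r).symm
  · rw [PosCone.add_point, hratio]

/-- The linear extension to the cone of an affine map into an `ℝ≥0`-module. -/
noncomputable def lift (g : A → M) (hg : IsAffine op moduleOp g) : Cone h →ₗ[ℝ≥0] M where
  toFun := WithZero.recZeroCoe 0 fun a => a.weight • g a.point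
  map_add' a b := by
    induction a using WithZero.recZeroCoe with
    | zero => simp
    | coe a =>
      induction b using WithZero.recZeroCoe with
      | zero => simp
      | coe b =>
        rw [← WithZero.coe_add]
        simp only [WithZero.recZeroCoe_coe]
        rw [PosCone.add_weight, PosCone.add_point, hg, add_smul_moduleOp_weightRatio a.pos]
  map_smul' c a := by
    rcases eq_zero_or_pos c with rfl | hc
    · simp
    induction a using WithZero.recZeroCoe with
    | zero => simp
    | coe a => simp [smul_coe hc, mul_smul]

theorem lift_of (g : A → M) (hg : IsAffine op moduleOp g) (x : A) :
    lift (h := h) g hg (of h x) = g x := one_smul _ _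

theorem isAffine_const_one : IsAffine op moduleOp fun _ => (1 : ℝ≥0) := fun r _ _ =>
  (IsBarycentricAlgebra.moduleOp.idem r 1).symm

theorem exists_of_eq_of_lift_one_eq_one {a : Cone h}
    (ha : lift (fun _ => (1 : ℝ≥0)) isAffine_const_one a = 1) : ∃ x, of h x = a := by
  induction a using WithZero.recZeroCoe with
  | zero => simp at ha
  | coe a =>
    have hweight : a.weight = 1 := (mul_one a.weight).symm.trans ha
    exact ⟨a.point, congrArg WithZero.coe (PosCone.ext hweight.symm rfl)⟩

end Cone

section Barycenter

variable {A B M X : Type*} {opA : I → A → A → A} {opB : I → B → B → B}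
  [AddCommMonoid M] [Module ℝ≥0 M]

theorem exists_cone_of_eq_linearCombination (h : IsBarycentricAlgebra opA) (w : StdSimplex ℝ≥0 X)
    (f : X → A) : ∃ x, Cone.of h x = Finsupp.linearCombination ℝ≥0 (Cone.of h ∘ f) w.weights := by
  refine Cone.exists_of_eq_of_lift_one_eq_one ?_
  rw [Finsupp.linearCombination_apply, map_finsuppSum]
  simp [Cone.lift_of, w.total]

/-- The barycenter of the points `f x` with weights `w x`. -/
noncomputable def barycenter (h : IsBarycentricAlgebra opA) (w : StdSimplex ℝ≥0 X) (f : X → A) :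
    A :=
  (exists_cone_of_eq_linearCombination h w f).choose

theorem cone_of_barycenter (h : IsBarycentricAlgebra opA) (w : StdSimplex ℝ≥0 X) (f : X → A) :
    Cone.of h (barycenter h w f) =
      Finsupp.linearCombination ℝ≥0 (Cone.of h ∘ f) w.weights :=
  (exists_cone_of_eq_linearCombination h w f).choose_spec

theorem IsAffine.comp {C : Type*} {opC : I → C → C → C} {g : B → C} {f : A → B}
    (hg : IsAffine opB opC g) (hf : IsAffine opA opB f) : IsAffine opA opC (g ∘ f) :=
  fun r x y => by rw [Function.comp_apply, hf, hg, Function.comp_apply, Function.comp_apply]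

theorem IsAffine.map_barycenter_eq_linearCombination {g : A → M} (hg : IsAffine opA moduleOp g)
    (h : IsBarycentricAlgebra opA) (w : StdSimplex ℝ≥0 X) (f : X → A) :
    g (barycenter h w f) = Finsupp.linearCombination ℝ≥0 (g ∘ f) w.weights := by
  rw [← Cone.lift_of (h := h) g hg, cone_of_barycenter, Finsupp.apply_linearCombination]
  congr 2
  ext x
  exact Cone.lift_of g hg (f x)

theorem IsAffine.map_barycenter {g : A → B} (hg : IsAffine opA opB g)
    (hA : IsBarycentricAlgebra opA) (hB : IsBarycentricAlgebra opB) (w : StdSimplex ℝ≥0 X)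
    (f : X → A) : g (barycenter hA w f) = barycenter hB w (g ∘ f) :=
  Cone.of_injective (h := hB) <| by
    rw [cone_of_barycenter]
    exact ((Cone.isAffine_of (h := hB)).comp hg).map_barycenter_eq_linearCombination hA w f

theorem barycenter_single (h : IsBarycentricAlgebra opA) (f : X → A) (x : X) :
    barycenter h (StdSimplex.single x) f = f x :=
  Cone.of_injective (h := h) <| by
    rw [cone_of_barycenter, StdSimplex.weights_single, Finsupp.linearCombination_single, one_smul,
      Function.comp_apply]

theorem barycenter_map {Y : Type*} (h : IsBarycentricAlgebra opA) (w : StdSimplex ℝ≥0 X)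
    (g : X → Y) (f : Y → A) :
    barycenter h (w.map g) f = barycenter h w (f ∘ g) :=
  Cone.of_injective (h := h) <| by
    rw [cone_of_barycenter, cone_of_barycenter, StdSimplex.weights_map,
      Finsupp.linearCombination_mapDomain, Function.comp_assoc]

theorem barycenter_prod (hA : IsBarycentricAlgebra opA) (hB : IsBarycentricAlgebra opB)
    (w : StdSimplex ℝ≥0 X) (f : X → A) (g : X → B) :
    barycenter (hA.prod hB) w (fun x => (f x, g x)) = (barycenter hA w f, barycenter hB w g) :=
  Prod.ext
    (IsAffine.map_barycenter (opA := prodOp opA opB) (g := Prod.fst) (fun _ _ _ => rfl) _ _ _ _)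
    (IsAffine.map_barycenter (opA := prodOp opA opB) (g := Prod.snd) (fun _ _ _ => rfl) _ _ _ _)

/-- The barycentric operation on finitely supported probability distributions. -/
noncomputable def stdSimplexOp (r : I) (w w' : StdSimplex ℝ≥0 X) : StdSimplex ℝ≥0 X :=
  convexCombPair (toNNReal r) (toNNReal (σ r)) zero_le zero_le
    (toNNReal_add_toNNReal_symm r) w w'

theorem isAffine_weights :
    IsAffine stdSimplexOp moduleOp (StdSimplex.weights : StdSimplex ℝ≥0 X → X →₀ ℝ≥0) :=
  fun _ _ _ => StdSimplex.weights_convexCombPair ..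

theorem isAffine_barycenter (h : IsBarycentricAlgebra opA) (f : X → A) :
    IsAffine stdSimplexOp opA fun w => barycenter h w f := fun r w w' =>
  Cone.of_injective (h := h) <| by
    rw [Cone.isAffine_of, moduleOp, cone_of_barycenter, cone_of_barycenter, cone_of_barycenter,
      isAffine_weights, moduleOp, map_add, map_smul, map_smul]

/-- Jensen's inequality: the positively homogeneous extension of `φ` to the cone is subadditive. -/
theorem map_barycenter_le_linearCombination [PartialOrder M] [IsOrderedAddMonoid M]
    [PosSMulMono ℝ≥0 M] (h : IsBarycentricAlgebra opA) {φ : A → M}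
    (hφ : ∀ r x y, φ (opA r x y) ≤ moduleOp r (φ x) (φ y)) (w : StdSimplex ℝ≥0 X) (f : X → A) :
    φ (barycenter h w f) ≤ Finsupp.linearCombination ℝ≥0 (φ ∘ f) w.weights := by
  let Φ : Cone h → M := WithZero.recZeroCoe 0 fun a => a.weight • φ a.point
  have hΦ_of (c : ℝ≥0) (x : A) : Φ (c • Cone.of h x) = c • φ x := by
    rcases eq_zero_or_pos c with rfl | hc
    · rw [zero_smul, zero_smul]
      rfl
    · rw [Cone.smul_of hc]
      rfl
  have hΦ_add (a b : Cone h) : Φ (a + b) ≤ Φ a + Φ b := by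
    induction a using WithZero.recZeroCoe with
    | zero => simp [Φ]
    | coe a =>
      induction b using WithZero.recZeroCoe with
      | zero => simp [Φ]
      | coe b =>
        rw [← WithZero.coe_add]
        simp only [Φ, WithZero.recZeroCoe_coe]
        rw [PosCone.add_weight, PosCone.add_point, ← add_smul_moduleOp_weightRatio a.pos]
        exact smul_le_smul_of_nonneg_left (hφ _ _ _) zero_le
  calc φ (barycenter h w f) = Φ (Cone.of h (barycenter h w f)) := by
        rw [← one_smul ℝ≥0 (Cone.of h _), hΦ_of, one_smul]
    _ = Φ (∑ x ∈ w.weights.support, w.weights x • Cone.of h (f x)) := by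
        rw [cone_of_barycenter]
        rfl
    _ ≤ ∑ x ∈ w.weights.support, Φ (w.weights x • Cone.of h (f x)) :=
        Finset.le_sum_of_subadditive _ le_rfl hΦ_add _ _
    _ = Finsupp.linearCombination ℝ≥0 (φ ∘ f) w.weights :=
        Finset.sum_congr rfl fun x _ => hΦ_of _ _

end Barycenter

/-! ### Random variables and couplings -/

/-- The `L^p` distance of two random variables with values in a metric space. -/
noncomputable def lpEdist {Ω X : Type*} [MeasurableSpace Ω] [PseudoEMetricSpace X] (p : ℝ)
    (P : Measure Ω) (f g : Ω → X) : ℝ≥0∞ :=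
  (∫⁻ ω, edist (f ω) (g ω) ^ p ∂P) ^ (1 / p)

section LpEdist

variable {Ω X : Type*} [MeasurableSpace Ω] [PseudoMetricSpace X] {p : ℝ} {P : Measure Ω}

theorem lpEdist_rpow (hp : 0 < p) (f g : Ω → X) :
    lpEdist p P f g ^ p = ∫⁻ ω, edist (f ω) (g ω) ^ p ∂P := by
  rw [lpEdist, one_div, ENNReal.rpow_inv_rpow hp.ne']

theorem lpEdist_lt_iff (hp : 0 < p) {f g : Ω → X} {C : ℝ≥0∞} :
    lpEdist p P f g < C ↔ ∫⁻ ω, edist (f ω) (g ω) ^ p ∂P < C ^ p := by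
  rw [← lpEdist_rpow hp, ENNReal.rpow_lt_rpow_iff hp]

theorem lpEdist_self (hp : 0 < p) (f : Ω → X) : lpEdist p P f f = 0 := by
  simp [lpEdist, hp]

theorem lpEdist_triangle (hp : 1 ≤ p) {f g h : Ω → X} (hf : AEStronglyMeasurable f P)
    (hg : AEStronglyMeasurable g P) (hh : AEStronglyMeasurable h P) :
    lpEdist p P f h ≤ lpEdist p P f g + lpEdist p P g h := by
  refine le_trans ?_ (ENNReal.lintegral_Lp_add_le (hf.edist hg) (hg.edist hh) hp)
  unfold lpEdist
  gcongr
  exact edist_triangle _ _ _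

theorem lintegral_tsum_rpow_le (hp : 1 ≤ p) {f : ℕ → Ω → ℝ≥0∞} (hf : ∀ n, AEMeasurable (f n) P) :
    (∫⁻ ω, (∑' n, f n ω) ^ p ∂P) ^ (1 / p) ≤ ∑' n, (∫⁻ ω, f n ω ^ p ∂P) ^ (1 / p) := by
  have hp0 : 0 < p := by linarith
  have hmeas (n : ℕ) : AEMeasurable (fun ω => ∑ k ∈ Finset.range n, f k ω) P :=
    Finset.aemeasurable_fun_sum _ fun k _ => hf k
  have hpartial (n : ℕ) : (∫⁻ ω, (∑ k ∈ Finset.range n, f k ω) ^ p ∂P) ^ (1 / p) ≤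
      ∑ k ∈ Finset.range n, (∫⁻ ω, f k ω ^ p ∂P) ^ (1 / p) := by
    induction n with
    | zero => simp [ENNReal.zero_rpow_of_pos, hp0]
    | succ n ih =>
      simp only [Finset.sum_range_succ]
      exact (ENNReal.lintegral_Lp_add_le (hmeas n) (hf n) hp).trans (add_le_add_left ih _)
  have hmono (ω : Ω) : Monotone fun n : ℕ => (∑ k ∈ Finset.range n, f k ω) ^ p := fun m n hmn => by
    dsimp only
    gcongr
  have hsup (ω : Ω) : (∑' n, f n ω) ^ p = ⨆ n, (∑ k ∈ Finset.range n, f k ω) ^ p :=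
    (iSup_eq_of_tendsto (hmono ω) ((ENNReal.continuous_rpow_const.tendsto _).comp
      ENNReal.summable.hasSum.tendsto_sum_nat)).symm
  simp only [hsup]
  rw [one_div, ENNReal.rpow_inv_le_iff hp0, lintegral_iSup' (fun n => (hmeas n).pow_const p)
    (Filter.Eventually.of_forall hmono)]
  refine iSup_le fun n => ?_
  rw [← ENNReal.rpow_inv_le_iff hp0, ← one_div]
  exact (hpartial n).trans (ENNReal.sum_le_tsum _)

theorem exists_stronglyMeasurable_lpEdist_le_tsum [CompleteSpace X] (hp : 1 ≤ p)
    {ξ : ℕ → Ω → X} (hξ : ∀ n, AEStronglyMeasurable (ξ n) P) {C : ℕ → ℝ≥0∞}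
    (hC : ∀ n, lpEdist p P (ξ n) (ξ (n + 1)) ≤ C n) (hsum : ∑' n, C n ≠ ∞) :
    ∃ ζ : Ω → X, StronglyMeasurable ζ ∧ ∀ n, lpEdist p P (ξ n) ζ ≤ ∑' k, C (n + k) := by
  have hp0 : 0 < p := by linarith
  have hmeas (n : ℕ) : AEMeasurable (fun ω => edist (ξ n ω) (ξ (n + 1) ω)) P :=
    (hξ n).edist (hξ (n + 1))
  have htail (n : ℕ) : (∫⁻ ω, (∑' k, edist (ξ (n + k) ω) (ξ (n + k + 1) ω)) ^ p ∂P) ^ (1 / p) ≤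
      ∑' k, C (n + k) :=
    (lintegral_tsum_rpow_le hp fun k => hmeas (n + k)).trans
      (ENNReal.tsum_le_tsum fun k => hC (n + k))
  have htotal : ∫⁻ ω, (∑' n, edist (ξ n ω) (ξ (n + 1) ω)) ^ p ∂P ≠ ∞ := fun htop => by
    have h0 := htail 0
    simp only [zero_add, htop, ENNReal.top_rpow_of_pos (one_div_pos.2 hp0), top_le_iff] at h0
    exact hsum h0
  have hconv : ∀ᵐ ω ∂P, ∃ y, Filter.Tendsto (fun n => ξ n ω) Filter.atTop (nhds y) := by
    filter_upwards [ae_lt_top' ((AEMeasurable.tsum hmeas).pow_const p) htotal] with ω hω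
    refine cauchySeq_tendsto_of_complete
      (cauchySeq_of_edist_le_of_tsum_ne_top _ (fun n => le_rfl) fun htop => hω.ne ?_)
    rw [htop, ENNReal.top_rpow_of_pos hp0]
  obtain ⟨ζ, hζ, hlim⟩ := exists_stronglyMeasurable_limit_of_tendsto_ae hξ hconv
  refine ⟨ζ, hζ, fun n => le_trans (ENNReal.rpow_le_rpow (lintegral_mono_ae ?_) ?_) (htail n)⟩
  · filter_upwards [hlim] with ω hω
    gcongr
    exact edist_le_tsum_of_edist_le_of_tendsto _ (fun n => le_rfl) hω n
  · positivity

end LpEdist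

/-- The integral of `d(x, y)^p` against a Borel measure on the square of a metric space. -/
noncomputable def transportCost (p : ℝ) {X : Type*} [PseudoEMetricSpace X]
    (γ : @Measure (X × X) (borel (X × X))) : ℝ≥0∞ :=
  @lintegral (X × X) (borel (X × X)) γ fun z => edist z.1 z.2 ^ p

theorem transportCost_swap_le (p : ℝ) {X : Type*} [PseudoEMetricSpace X]
    (γ : @Measure (X × X) (borel (X × X))) :
    transportCost p (@Measure.map _ _ (borel _) (borel _) Prod.swap γ) ≤ transportCost p γ := by
  let : MeasurableSpace (X × X) := borel (X × X)
  refine (lintegral_map_le _ _).trans_eq ?_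
  simp only [transportCost, Prod.fst_swap, Prod.snd_swap, edist_comm]

section Coupling

variable {Ω X : Type*} [MeasurableSpace Ω] [MetricSpace X] [MeasurableSpace X] {p : ℝ}
  {P : Measure Ω} {μ ν : Measure X}

theorem wassersteinDist_rpow (hp : 0 < p) (μ ν : Measure X) : wassersteinDist p μ ν ^ p =
    ⨅ (γ : @Measure (X × X) (borel (X × X))) (_ : IsCoupling μ ν γ), transportCost p γ := by
  rw [wassersteinDist, one_div, ENNReal.rpow_inv_rpow hp.ne']
  rfl

theorem IsCoupling.wassersteinDist_rpow_le (hp : 0 < p) {γ : @Measure (X × X) (borel (X × X))}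
    (hγ : IsCoupling μ ν γ) : wassersteinDist p μ ν ^ p ≤ transportCost p γ := by
  rw [wassersteinDist_rpow hp]
  exact iInf₂_le γ hγ

theorem exists_isCoupling_transportCost_lt (hp : 0 < p) {C : ℝ≥0∞}
    (h : wassersteinDist p μ ν < C) :
    ∃ γ : @Measure (X × X) (borel (X × X)), IsCoupling μ ν γ ∧ transportCost p γ < C ^ p := by
  rw [← ENNReal.rpow_lt_rpow_iff hp, wassersteinDist_rpow hp] at h
  simpa only [iInf_lt_iff, exists_prop] using h

variable [BorelSpace X]

theorem wassersteinDist_map_le_lpEdist [IsProbabilityMeasure P] (hp : 0 < p) {f g : Ω → X}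
    (hf : AEStronglyMeasurable f P) (hg : AEStronglyMeasurable g P) :
    wassersteinDist p (P.map f) (P.map g) ≤ lpEdist p P f g := by
  let : MeasurableSpace (X × X) := borel (X × X)
  have : BorelSpace (X × X) := ⟨rfl⟩
  have hfg : AEMeasurable (fun ω => (f ω, g ω)) P := (hf.prodMk hg).aemeasurable
  have hcoupling : IsCoupling (P.map f) (P.map g) (P.map fun ω => (f ω, g ω)) :=
    ⟨Measure.isProbabilityMeasure_map hfg,
      AEMeasurable.map_map_of_aemeasurable continuous_fst.measurable.aemeasurable hfg,
      AEMeasurable.map_map_of_aemeasurable continuous_snd.measurable.aemeasurable hfg⟩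
  rw [← ENNReal.rpow_le_rpow_iff hp, lpEdist_rpow hp]
  exact (hcoupling.wassersteinDist_rpow_le hp).trans (lintegral_map_le _ _)

theorem IsCoupling.swap {γ : @Measure (X × X) (borel (X × X))} (hγ : IsCoupling μ ν γ) :
    IsCoupling ν μ (@Measure.map _ _ (borel _) (borel _) Prod.swap γ) := by
  let : MeasurableSpace (X × X) := borel (X × X)
  have : BorelSpace (X × X) := ⟨rfl⟩
  have := hγ.isProbabilityMeasure
  have hswap : Measurable (Prod.swap : X × X → X × X) := continuous_swap.measurable
  exact ⟨Measure.isProbabilityMeasure_map hswap.aemeasurable,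
    (Measure.map_map continuous_fst.measurable hswap).trans hγ.map_snd,
    (Measure.map_map continuous_snd.measurable hswap).trans hγ.map_fst⟩

theorem wassersteinDist_comm_le (hp : 0 < p) (μ ν : Measure X) :
    wassersteinDist p μ ν ≤ wassersteinDist p ν μ := by
  rw [← ENNReal.rpow_le_rpow_iff hp, wassersteinDist_rpow hp ν μ]
  exact le_iInf₂ fun γ hγ => (hγ.swap.wassersteinDist_rpow_le hp).trans (transportCost_swap_le p γ)

theorem wassersteinDist_comm (hp : 0 < p) (μ ν : Measure X) :
    wassersteinDist p μ ν = wassersteinDist p ν μ :=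
  le_antisymm (wassersteinDist_comm_le hp μ ν) (wassersteinDist_comm_le hp ν μ)

theorem IsCoupling.convexComb {μ' ν' : Measure X} {γ γ' : @Measure (X × X) (borel (X × X))}
    (h : IsCoupling μ ν γ) (h' : IsCoupling μ' ν' γ') {a b : ℝ≥0∞} (hab : a + b = 1) :
    IsCoupling (a • μ + b • μ') (a • ν + b • ν') (a • γ + b • γ') := by
  let : MeasurableSpace (X × X) := borel (X × X)
  have : BorelSpace (X × X) := ⟨rfl⟩
  refine ⟨⟨?_⟩, ?_, ?_⟩
  · rw [Measure.add_apply, Measure.smul_apply, Measure.smul_apply,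
      h.isProbabilityMeasure.measure_univ, h'.isProbabilityMeasure.measure_univ, smul_eq_mul,
      smul_eq_mul, mul_one, mul_one, hab]
  · rw [← h.map_fst, ← h'.map_fst, ← Measure.map_smul, ← Measure.map_smul]
    exact Measure.map_add _ _ continuous_fst.measurable
  · rw [← h.map_snd, ← h'.map_snd, ← Measure.map_smul, ← Measure.map_smul]
    exact Measure.map_add _ _ continuous_snd.measurable

theorem wassersteinDist_convexComb_rpow_le (hp : 0 < p) (μ ν μ' ν' : Measure X) {a b : ℝ≥0∞}
    (hab : a + b = 1) :
    wassersteinDist p (a • μ + b • μ') (a • ν + b • ν') ^ p ≤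
      a * wassersteinDist p μ ν ^ p + b * wassersteinDist p μ' ν' ^ p := by
  rcases eq_or_ne a 0 with rfl | ha
  · simp [show b = 1 by simpa using hab]
  rcases eq_or_ne b 0 with rfl | hb
  · simp [show a = 1 by simpa using hab]
  have ha' : a ≠ ∞ := ne_top_of_le_ne_top ENNReal.one_ne_top (hab ▸ le_self_add)
  have hb' : b ≠ ∞ := ne_top_of_le_ne_top ENNReal.one_ne_top (hab ▸ le_add_self)
  rw [wassersteinDist_rpow hp μ ν, wassersteinDist_rpow hp μ' ν', iInf_subtype', iInf_subtype',
    ENNReal.mul_iInf_of_ne ha ha', ENNReal.mul_iInf_of_ne hb hb']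
  refine ENNReal.le_iInf_add_iInf ?_
  rintro ⟨γ, hγ⟩ ⟨γ', hγ'⟩
  refine ((hγ.convexComb hγ' hab).wassersteinDist_rpow_le hp).trans_eq ?_
  rw [transportCost, lintegral_add_measure, lintegral_smul_measure, lintegral_smul_measure]
  rfl

end Coupling

/-! ### Separation of measures -/

section Separation

variable {X : Type*} [MetricSpace X] [MeasurableSpace X] [BorelSpace X] {p : ℝ} {μ ν : Measure X}

theorem IsCoupling.measure_le_measure_thickening_add {γ : @Measure (X × X) (borel (X × X))}
    (hγ : IsCoupling μ ν γ) (hp : 0 < p) {ε : ℝ≥0∞} (hε : ε ≠ 0) (hε' : ε ≠ ∞) {B : Set X}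
    (hB : MeasurableSet B) :
    μ B ≤ ν (Metric.thickening ε.toReal B) + transportCost p γ / ε ^ p := by
  let : MeasurableSpace (X × X) := borel (X × X)
  have : BorelSpace (X × X) := ⟨rfl⟩
  have hfar : γ {z | ε ^ p ≤ edist z.1 z.2 ^ p} ≤ transportCost p γ / ε ^ p :=
    meas_ge_le_lintegral_div (continuous_edist.measurable.pow_const p).aemeasurable
      (by simp [hε, hε']) (by finiteness)
  have hμ : μ B = γ (Prod.fst ⁻¹' B) := by
    rw [← hγ.map_fst, Measure.map_apply continuous_fst.measurable hB]
  have hν : ν (Metric.thickening ε.toReal B) = γ (Prod.snd ⁻¹' Metric.thickening ε.toReal B) := by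
    rw [← hγ.map_snd, Measure.map_apply continuous_snd.measurable
      Metric.isOpen_thickening.measurableSet]
  rw [hμ, hν]
  refine (measure_mono fun z hz => ?_).trans ((measure_union_le _ _).trans (by gcongr))
  rw [mem_union, mem_ofPred_eq, ENNReal.rpow_le_rpow_iff hp, or_iff_not_imp_right, not_le]
  intro hz'
  rw [mem_preimage, Metric.mem_thickening_iff]
  exact ⟨z.1, hz, by rwa [edist_comm, edist_dist, ENNReal.ofReal_lt_iff_lt_toReal dist_nonneg hε']
    at hz'⟩

theorem levyProkhorovEDist_rpow_le_wassersteinDist_rpow [IsProbabilityMeasure μ]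
    [IsProbabilityMeasure ν] (hp : 0 < p) :
    levyProkhorovEDist μ ν ^ (p + 1) ≤ wassersteinDist p μ ν ^ p := by
  have hp1 : 0 < p + 1 := by linarith
  rw [wassersteinDist_rpow hp]
  refine le_iInf₂ fun γ hγ => ?_
  rw [← ENNReal.le_rpow_inv_iff hp1]
  refine levyProkhorovEDist_le_of_forall_le μ ν _ fun ε B hε hε' hB => ?_
  have hε0 : ε ≠ 0 := (zero_le.trans_lt hε).ne'
  refine (hγ.measure_le_measure_thickening_add hp hε0 hε'.ne hB).trans ?_
  gcongr
  rw [ENNReal.div_le_iff (by simp [hε0, hε'.ne]) (by finiteness)]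
  rw [ENNReal.rpow_inv_lt_iff hp1, add_comm, ENNReal.rpow_add _ _ hε0 hε'.ne,
    ENNReal.rpow_one] at hε
  exact hε.le

theorem eq_of_wassersteinDist_eq_zero [IsProbabilityMeasure μ] [IsProbabilityMeasure ν]
    (hp : 0 < p) (h : wassersteinDist p μ ν = 0) : μ = ν := by
  have hLP : levyProkhorovEDist μ ν = 0 := by
    have hle := levyProkhorovEDist_rpow_le_wassersteinDist_rpow hp (μ := μ) (ν := ν)
    have hp1 : 0 < p + 1 := by linarith
    rwa [h, ENNReal.zero_rpow_of_pos hp, nonpos_iff_eq_zero, ENNReal.rpow_eq_zero_iff_of_pos hp1]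
      at hle
  refine ext_of_generate_finite _ (BorelSpace.measurable_eq.trans borel_eq_generateFrom_isClosed)
    isPiSystem_isClosed (fun F hF => ?_) (by simp)
  exact measure_eq_measure_of_levyProkhorovEDist_eq_zero_of_isClosed hLP hF
    ⟨1, one_pos, measure_ne_top _ _⟩ ⟨1, one_pos, measure_ne_top _ _⟩

end Separation

/-! ### Radon measures and separable supports -/

section Radon

variable {Ω X : Type*} [MeasurableSpace Ω] [MetricSpace X] [MeasurableSpace X] [BorelSpace X]

/-- A finite Radon measure is concentrated on a σ-compact set, which is separable. -/
theorem aestronglyMeasurable_id_of_innerRegular (μ : Measure X) [IsFiniteMeasure μ]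
    [μ.InnerRegular] : AEStronglyMeasurable id μ := by
  have hcompact (n : ℕ) : ∃ K, IsCompact K ∧ μ Kᶜ ≤ (n : ℝ≥0∞)⁻¹ := by
    simpa using isTightMeasureSet_iff_exists_isCompact_measure_compl_le.1
      (isTightMeasureSet_singleton_of_innerRegular (μ := μ)) (n : ℝ≥0∞)⁻¹ (by simp)
  choose K hK hμK using hcompact
  refine aestronglyMeasurable_iff_aemeasurable_separable.2 ⟨aemeasurable_id, ⋃ n, K n,
    TopologicalSpace.IsSeparable.iUnion fun n => (hK n).isSeparable, ?_⟩
  refine measure_mono_null (t := ⋂ n, (K n)ᶜ) (fun x hx => by simpa using hx) ?_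
  exact le_antisymm (ge_of_tendsto' ENNReal.tendsto_inv_nat_nhds_zero fun n =>
    (measure_mono (iInter_subset _ n)).trans (hμK n)) zero_le

theorem exists_isClosed_isSeparable_forall_ae_mem {ι : Type*} [Countable ι] (μ : ι → Measure X)
    [∀ i, IsFiniteMeasure (μ i)] [∀ i, (μ i).InnerRegular] :
    ∃ Y : Set X, IsClosed Y ∧ TopologicalSpace.IsSeparable Y ∧ ∀ i, ∀ᵐ x ∂μ i, x ∈ Y := by
  choose S hS hμS using fun i =>
    (aestronglyMeasurable_id_of_innerRegular (μ i)).isSeparable_ae_range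
  refine ⟨closure (⋃ i, S i), isClosed_closure, (TopologicalSpace.IsSeparable.iUnion hS).closure,
    fun i => ?_⟩
  filter_upwards [hμS i] with x hx using subset_closure (mem_iUnion_of_mem i hx)

theorem innerRegular_map_of_stronglyMeasurable [CompleteSpace X] {P : Measure Ω}
    [IsFiniteMeasure P] {f : Ω → X} (hf : StronglyMeasurable f) : (P.map f).InnerRegular := by
  let Y : Set X := closure (range f)
  have hYsep : TopologicalSpace.SeparableSpace Y := hf.isSeparable_range.closure.separableSpace
  have := UniformSpace.secondCountable_of_separable Y
  have : CompleteSpace Y := isClosed_closure.completeSpace_coe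
  have hfY : Measurable (codRestrict f Y fun ω => subset_closure (mem_range_self ω)) :=
    hf.measurable.codRestrict _
  have hlaw : P.map f = (P.map (codRestrict f Y fun ω => subset_closure (mem_range_self ω))).map
      Subtype.val := (Measure.map_map measurable_subtype_coe hfY).symm
  rw [hlaw]
  exact Measure.InnerRegular.map_of_continuous continuous_subtype_val

end Radon

/-! ### Gluing of couplings -/

section Gluing

open ProbabilityTheory

theorem map_compProd_comap {α β δ : Type*} [MeasurableSpace α] [MeasurableSpace β]
    [MeasurableSpace δ] (ν : Measure α) [SFinite ν] {f : α → β} (hf : Measurable f)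
    (κ : Kernel β δ) [IsSFiniteKernel κ] :
    (ν ⊗ₘ κ.comap f hf).map (Prod.map f id) = ν.map f ⊗ₘ κ := by
  ext s hs
  have hprod : Measurable (Prod.map f id : α × δ → β × δ) := by fun_prop
  rw [Measure.map_apply hprod hs, Measure.compProd_apply (hprod hs), Measure.compProd_apply hs,
    lintegral_map (Kernel.measurable_kernel_prodMk_left hs) hf]
  rfl

variable {Y : Type*} [MeasurableSpace Y]

/-- The law of the (time-inhomogeneous) Markov chain with initial law `μ` and transition kernels
`κ n`, as a measure on the space of trajectories. -/
noncomputable def markovChain (μ : Measure Y) (κ : ℕ → Kernel Y Y) [∀ n, IsMarkovKernel (κ n)] :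
    Measure (ℕ → Y) :=
  Kernel.trajMeasure (X := fun _ => Y) μ fun n =>
    (κ n).comap (fun x : Finset.Iic n → Y => x ⟨n, Finset.mem_Iic.2 le_rfl⟩)
      (measurable_pi_apply _)

variable (μ : Measure Y) (κ : ℕ → Kernel Y Y) [∀ n, IsMarkovKernel (κ n)]

instance isProbabilityMeasure_markovChain [IsProbabilityMeasure μ] :
    IsProbabilityMeasure (markovChain μ κ) :=
  inferInstanceAs (IsProbabilityMeasure (Kernel.trajMeasure _ _))

theorem markovChain_map_zero : (markovChain μ κ).map (fun ω => ω 0) = μ := by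
  have hstart : (markovChain μ κ).map (Preorder.frestrictLe (π := fun _ => Y) 0) =
      μ.map (MeasurableEquiv.piUnique fun _ : Finset.Iic 0 => Y).symm := by
    rw [markovChain, Kernel.trajMeasure, Measure.map_comp _ _ (by fun_prop),
      Kernel.traj_map_frestrictLe, Kernel.partialTraj_self, Measure.id_comp]
  have heval := congrArg (Measure.map fun x : Finset.Iic 0 → Y => x default) hstart
  rw [Measure.map_map (by fun_prop) (by fun_prop), Measure.map_map (by fun_prop) (by fun_prop)]
    at heval
  exact heval.trans Measure.map_id

theorem markovChain_map_pair [IsProbabilityMeasure μ] (n : ℕ) :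
    (markovChain μ κ).map (fun ω => (ω n, ω (n + 1))) =
      (markovChain μ κ).map (fun ω => ω n) ⊗ₘ κ n := by
  let last (x : Finset.Iic n → Y) : Y := x ⟨n, Finset.mem_Iic.2 le_rfl⟩
  have hlast : Measurable last := measurable_pi_apply _
  have hpast := Kernel.map_frestrictLe_trajMeasure_compProd_eq_map_trajMeasure
    (X := fun _ => Y) (μ₀ := μ) (a := n)
    (κ := fun n => (κ n).comap (fun x : Finset.Iic n → Y => x ⟨n, Finset.mem_Iic.2 le_rfl⟩)
      (measurable_pi_apply _))
  have hlaw := congrArg (Measure.map (Prod.map last id)) hpast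
  rw [Measure.map_map (by fun_prop) (by fun_prop)] at hlaw
  refine hlaw.symm.trans ((map_compProd_comap _ hlast _).trans ?_)
  rw [Measure.map_map hlast (by fun_prop)]
  rfl

/-- The law of the Markov chain whose transition kernels disintegrate the couplings. -/
theorem exists_measure_map_pair_eq [StandardBorelSpace Y] (γ : ℕ → Measure (Y × Y))
    [∀ n, IsProbabilityMeasure (γ n)] (hγ : ∀ n, (γ n).snd = (γ (n + 1)).fst) :
    ∃ P : Measure (ℕ → Y), IsProbabilityMeasure P ∧
      ∀ n, P.map (fun ω => (ω n, ω (n + 1))) = γ n := by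
  have : Nonempty Y := (nonempty_of_isProbabilityMeasure (γ 0)).map Prod.fst
  have hpair (n : ℕ) (hn : (markovChain (γ 0).fst fun n => (γ n).condKernel).map (fun ω => ω n) =
      (γ n).fst) : (markovChain (γ 0).fst fun n => (γ n).condKernel).map
        (fun ω => (ω n, ω (n + 1))) = γ n := by
    rw [markovChain_map_pair, hn, (γ n).disintegrate]
  refine ⟨_, isProbabilityMeasure_markovChain (γ 0).fst fun n => (γ n).condKernel,
    fun n => hpair n ?_⟩
  induction n with
  | zero => exact markovChain_map_zero _ _
  | succ n ih =>
    rw [← Measure.snd_map_prodMk (X := fun ω => ω n) (by fun_prop), hpair n ih, hγ]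

end Gluing

section RandomSequence

variable {X : Type*} [MetricSpace X] [MeasurableSpace X] [BorelSpace X] {p : ℝ} {μ ν : Measure X}
  {γ : @Measure (X × X) (borel (X × X))}

theorem IsCoupling.exists_map_subtype_eq (hγ : IsCoupling μ ν γ) {Y : Set X} (hY : IsClosed Y)
    [SecondCountableTopology Y] (hμ : ∀ᵐ x ∂μ, x ∈ Y) (hν : ∀ᵐ x ∂ν, x ∈ Y) :
    ∃ γ' : Measure (Y × Y),
      @Measure.map _ _ _ (borel _) (Prod.map Subtype.val Subtype.val) γ' = γ := by
  let : MeasurableSpace (X × X) := borel (X × X)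
  have : BorelSpace (X × X) := ⟨rfl⟩
  have hemb : MeasurableEmbedding (Prod.map Subtype.val Subtype.val : Y × Y → X × X) :=
    (hY.isClosedEmbedding_subtypeVal.prodMap hY.isClosedEmbedding_subtypeVal).measurableEmbedding
  have hfst : ∀ᵐ z ∂γ, z.1 ∈ Y :=
    ae_of_ae_map continuous_fst.measurable.aemeasurable (hγ.map_fst.symm ▸ hμ)
  have hsnd : ∀ᵐ z ∂γ, z.2 ∈ Y :=
    ae_of_ae_map continuous_snd.measurable.aemeasurable (hγ.map_snd.symm ▸ hν)
  refine ⟨γ.comap (Prod.map Subtype.val Subtype.val), ?_⟩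
  rw [hemb.map_comap, range_prodMap, Subtype.range_coe]
  exact Measure.restrict_eq_self_of_ae_mem (hfst.and hsnd)

theorem IsCoupling.exists_subtype (hγ : IsCoupling μ ν γ) {Y : Set X} (hY : IsClosed Y)
    [SecondCountableTopology Y] (hμ : ∀ᵐ x ∂μ, x ∈ Y) (hν : ∀ᵐ x ∂ν, x ∈ Y) :
    ∃ γ' : Measure (Y × Y), IsProbabilityMeasure γ' ∧ γ'.fst.map Subtype.val = μ ∧
      γ'.snd.map Subtype.val = ν ∧ ∫⁻ z, edist z.1 z.2 ^ p ∂γ' = transportCost p γ := by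
  let : MeasurableSpace (X × X) := borel (X × X)
  have : BorelSpace (X × X) := ⟨rfl⟩
  obtain ⟨γ', rfl⟩ := hγ.exists_map_subtype_eq hY hμ hν
  have hval : Measurable (Prod.map Subtype.val Subtype.val : Y × Y → X × X) := by fun_prop
  have := hγ.isProbabilityMeasure
  refine ⟨γ', Measure.isProbabilityMeasure_of_map (Prod.map Subtype.val Subtype.val), ?_, ?_, ?_⟩
  · rw [← hγ.map_fst, Measure.fst, Measure.map_map measurable_subtype_coe measurable_fst,
      Measure.map_map continuous_fst.measurable hval]
    rfl
  · rw [← hγ.map_snd, Measure.snd, Measure.map_map measurable_subtype_coe measurable_snd,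
      Measure.map_map continuous_snd.measurable hval]
    rfl
  · rw [transportCost, lintegral_map (continuous_edist.measurable.pow_const p) hval]
    rfl

/-- The measures live on a common separable closed set, a standard Borel space, on which
near-optimal couplings of consecutive terms can be disintegrated and glued. -/
theorem exists_forall_map_eq_lpEdist_lt {X : Type u} [MetricSpace X] [CompleteSpace X]
    [MeasurableSpace X] [BorelSpace X] (hp : 0 < p) (μ : ℕ → Measure X) [∀ n, IsFiniteMeasure (μ n)]
    [∀ n, (μ n).InnerRegular] {C : ℕ → ℝ≥0∞}
    (hC : ∀ n, wassersteinDist p (μ n) (μ (n + 1)) < C n) :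
    ∃ (Ω : Type u) (_ : MeasurableSpace Ω) (P : Measure Ω) (ξ : ℕ → Ω → X),
      IsProbabilityMeasure P ∧ (∀ n, StronglyMeasurable (ξ n)) ∧ (∀ n, P.map (ξ n) = μ n) ∧
        ∀ n, lpEdist p P (ξ n) (ξ (n + 1)) < C n := by
  obtain ⟨Y, hY, hYsep, hμ⟩ := exists_isClosed_isSeparable_forall_ae_mem μ
  have := hYsep.separableSpace
  have := UniformSpace.secondCountable_of_separable Y
  have := hY.completeSpace_coe
  choose γ hγ hcost using fun n => exists_isCoupling_transportCost_lt hp (hC n)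
  choose γ' hγ' hfst hsnd hcost' using fun n =>
    (hγ n).exists_subtype (p := p) hY (hμ n) (hμ (n + 1))
  obtain ⟨P, hP, hPγ⟩ := exists_measure_map_pair_eq γ' fun n =>
    (MeasurableEmbedding.subtype_coe hY.measurableSet).map_injective
      ((hsnd n).trans (hfst (n + 1)).symm)
  refine ⟨ℕ → Y, inferInstance, P, fun n ω => ω n, hP, fun n =>
    continuous_subtype_val.stronglyMeasurable.comp_measurable (measurable_pi_apply n),
    fun n => ?_, fun n => ?_⟩
  · rw [← hfst n, ← hPγ n, Measure.fst_map_prodMk (by fun_prop),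
      Measure.map_map measurable_subtype_coe (by fun_prop)]
    rfl
  · rw [lpEdist_lt_iff hp]
    refine lt_of_eq_of_lt ?_ (hcost n)
    rw [← hcost' n, ← hPγ n, lintegral_map (by fun_prop) (by fun_prop)]
    rfl

theorem wassersteinDist_self (hp : 0 < p) (μ : Measure X) [IsProbabilityMeasure μ]
    [μ.InnerRegular] : wassersteinDist p μ μ = 0 := by
  have hid := aestronglyMeasurable_id_of_innerRegular μ
  simpa only [Measure.map_id, lpEdist_self hp, nonpos_iff_eq_zero] using
    wassersteinDist_map_le_lpEdist hp hid hid

theorem wassersteinDist_le_add_of_lt_of_lt [CompleteSpace X] (hp : 1 ≤ p) {μ ν ρ : Measure X}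
    [IsProbabilityMeasure μ] [IsProbabilityMeasure ν] [IsProbabilityMeasure ρ] [μ.InnerRegular]
    [ν.InnerRegular] [ρ.InnerRegular] {a b : ℝ≥0∞} (ha : wassersteinDist p μ ν < a)
    (hb : wassersteinDist p ν ρ < b) : wassersteinDist p μ ρ ≤ a + b := by
  have hp0 : 0 < p := by linarith
  let m : ℕ → Measure X
    | 0 => μ
    | 1 => ν
    | _ => ρ
  let C : ℕ → ℝ≥0∞
    | 0 => a
    | 1 => b
    | _ => 1
  have hprob : ∀ n, IsProbabilityMeasure (m n)
    | 0 | 1 | _ + 2 => by assumption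
  have hradon : ∀ n, (m n).InnerRegular
    | 0 | 1 | _ + 2 => by assumption
  have hC : ∀ n, wassersteinDist p (m n) (m (n + 1)) < C n
    | 0 => ha
    | 1 => hb
    | _ + 2 => (wassersteinDist_self hp0 ρ).trans_lt one_pos
  obtain ⟨Ω, _, P, ξ, hP, hξ, hlaw, hdist⟩ := exists_forall_map_eq_lpEdist_lt hp0 m hC
  calc wassersteinDist p (m 0) (m 2)
      = wassersteinDist p (P.map (ξ 0)) (P.map (ξ 2)) := by rw [hlaw, hlaw]
    _ ≤ lpEdist p P (ξ 0) (ξ 2) := wassersteinDist_map_le_lpEdist hp0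
        (hξ 0).aestronglyMeasurable (hξ 2).aestronglyMeasurable
    _ ≤ lpEdist p P (ξ 0) (ξ 1) + lpEdist p P (ξ 1) (ξ 2) :=
        lpEdist_triangle hp (hξ 0).aestronglyMeasurable (hξ 1).aestronglyMeasurable
          (hξ 2).aestronglyMeasurable
    _ ≤ a + b := add_le_add (hdist 0).le (hdist 1).le

theorem wassersteinDist_triangle [CompleteSpace X] (hp : 1 ≤ p) (μ ν ρ : Measure X)
    [IsProbabilityMeasure μ] [IsProbabilityMeasure ν] [IsProbabilityMeasure ρ] [μ.InnerRegular]
    [ν.InnerRegular] [ρ.InnerRegular] :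
    wassersteinDist p μ ρ ≤ wassersteinDist p μ ν + wassersteinDist p ν ρ := by
  rcases eq_or_ne (wassersteinDist p μ ν) ∞ with hμν | hμν
  · simp [hμν]
  rcases eq_or_ne (wassersteinDist p ν ρ) ∞ with hνρ | hνρ
  · simp [hνρ]
  refine ENNReal.le_of_forall_pos_le_add fun ε hε _ => ?_
  have hε2 : ((ε / 2 : ℝ≥0) : ℝ≥0∞) ≠ 0 := by simpa using hε.ne'
  refine (wassersteinDist_le_add_of_lt_of_lt hp (ENNReal.lt_add_right hμν hε2)
    (ENNReal.lt_add_right hνρ hε2)).trans_eq ?_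
  rw [add_add_add_comm, ← ENNReal.coe_add, add_halves]

end RandomSequence

namespace WassersteinSpace

variable {X : Type*} [MetricSpace X] [MeasurableSpace X] {p : ℝ}

@[ext]
theorem ext {μ ν : WassersteinSpace p X} (h : μ.measure = ν.measure) : μ = ν := by
  cases μ
  cases ν
  congr

instance (μ : WassersteinSpace p X) : IsProbabilityMeasure μ.measure := μ.isProbabilityMeasure

instance (μ : WassersteinSpace p X) : μ.measure.InnerRegular := μ.isRadon

variable [BorelSpace X] [CompleteSpace X]

/-- The Wasserstein metric on `P_p(X)`. -/
noncomputable abbrev emetricSpace (hp : 1 ≤ p) : EMetricSpace (WassersteinSpace p X) where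
  edist μ ν := wassersteinDist p μ.measure ν.measure
  edist_self μ := wassersteinDist_self (by linarith) μ.measure
  edist_comm μ ν := wassersteinDist_comm (by linarith) μ.measure ν.measure
  edist_triangle μ ν ρ := wassersteinDist_triangle hp μ.measure ν.measure ρ.measure
  eq_of_edist_eq_zero h := WassersteinSpace.ext (eq_of_wassersteinDist_eq_zero (by linarith) h)

end WassersteinSpace

section Limit

variable {Ω X : Type*} [MeasurableSpace Ω] [MetricSpace X] [MeasurableSpace X] [BorelSpace X]
  {p : ℝ} {P : Measure Ω}

theorem hasFiniteMoment_map_iff (hp : 0 < p) {f : Ω → X} (hf : AEMeasurable f P) :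
    HasFiniteMoment p (P.map f) ↔ ∃ x₀, lpEdist p P (fun _ => x₀) f < ∞ := by
  refine exists_congr fun x₀ => ?_
  rw [lpEdist_lt_iff hp, ENNReal.top_rpow_of_pos hp, lintegral_map' (by fun_prop) hf]

theorem hasFiniteMoment_map_of_lpEdist_lt_top (hp : 1 ≤ p) {f g : Ω → X}
    (hf : AEStronglyMeasurable f P) (hg : AEStronglyMeasurable g P)
    (hmoment : HasFiniteMoment p (P.map f)) (hfg : lpEdist p P f g < ∞) :
    HasFiniteMoment p (P.map g) := by
  have hp0 : 0 < p := by linarith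
  rw [hasFiniteMoment_map_iff hp0 hf.aemeasurable] at hmoment
  rw [hasFiniteMoment_map_iff hp0 hg.aemeasurable]
  obtain ⟨x₀, hx₀⟩ := hmoment
  exact ⟨x₀, (lpEdist_triangle hp aestronglyMeasurable_const hf hg).trans_lt
    (ENNReal.add_lt_top.2 ⟨hx₀, hfg⟩)⟩

theorem WassersteinSpace.exists_wassersteinDist_le_tsum [CompleteSpace X] (hp : 1 ≤ p)
    (μ : ℕ → WassersteinSpace p X) {C : ℕ → ℝ≥0∞}
    (hC : ∀ n, wassersteinDist p (μ n).measure (μ (n + 1)).measure < C n) (hsum : ∑' n, C n ≠ ∞) :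
    ∃ ν : WassersteinSpace p X,
      ∀ n, wassersteinDist p (μ n).measure ν.measure ≤ ∑' k, C (n + k) := by
  have hp0 : 0 < p := by linarith
  obtain ⟨Ω, _, P, ξ, hP, hξ, hlaw, hdist⟩ :=
    exists_forall_map_eq_lpEdist_lt hp0 (fun n => (μ n).measure) hC
  obtain ⟨ζ, hζ, hlim⟩ := exists_stronglyMeasurable_lpEdist_le_tsum hp
    (fun n => (hξ n).aestronglyMeasurable) (fun n => (hdist n).le) hsum
  refine ⟨⟨P.map ζ, Measure.isProbabilityMeasure_map hζ.measurable.aemeasurable,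
    innerRegular_map_of_stronglyMeasurable hζ, ?_⟩, fun n => ?_⟩
  · refine hasFiniteMoment_map_of_lpEdist_lt_top hp (hξ 0).aestronglyMeasurable
      hζ.aestronglyMeasurable ?_ ((hlim 0).trans_lt ?_)
    · rw [hlaw 0]
      exact (μ 0).hasFiniteMoment
    · simpa only [zero_add] using hsum.lt_top
  · rw [← hlaw n]
    exact (wassersteinDist_map_le_lpEdist hp0 (hξ n).aestronglyMeasurable
      hζ.aestronglyMeasurable).trans (hlim n)

theorem WassersteinSpace.completeSpace [CompleteSpace X] (hp : 1 ≤ p) :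
    @CompleteSpace (WassersteinSpace p X) (emetricSpace hp).toUniformSpace := by
  let _ : EMetricSpace (WassersteinSpace p X) := emetricSpace hp
  let C (n : ℕ) : ℝ≥0∞ := 2⁻¹ ^ n
  have hsum : ∑' n, C n ≠ ∞ := by simp [C, ENNReal.tsum_geometric]
  refine EMetric.complete_of_convergent_controlled_sequences C
    (fun n => ENNReal.pow_pos (by simp) n) fun μ hμ => ?_
  obtain ⟨ν, hν⟩ := exists_wassersteinDist_le_tsum hp μ
    (fun n => hμ n n (n + 1) le_rfl n.le_succ) hsum
  refine ⟨ν, tendsto_iff_edist_tendsto_0.2 ?_⟩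
  refine tendsto_of_tendsto_of_tendsto_of_le_of_le tendsto_const_nhds ?_ (fun _ => zero_le) hν
  simpa only [add_comm] using ENNReal.tendsto_sum_nat_add C hsum

end Limit

/-! ### The algebra of measures -/

theorem moduleOp_eq_ofReal_smul {M : Type*} [AddCommMonoid M] [Module ℝ≥0∞ M] (r : I) (x y : M) :
    moduleOp r x y = ENNReal.ofReal r • x + ENNReal.ofReal (1 - r) • y := by
  have hcoe (r : I) : ENNReal.ofReal r = toNNReal r := ENNReal.ofReal_eq_coe_nnreal r.2.1
  rw [moduleOp, ENNReal.smul_def, ENNReal.smul_def, ← hcoe, ← hcoe, coe_symm_eq]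

namespace WassersteinSpace

variable {X : Type*} [MetricSpace X] [MeasurableSpace X] {p : ℝ}

theorem isAffine_measure (hp : 1 ≤ p) :
    IsAffine (convexComb hp) moduleOp (measure : WassersteinSpace p X → Measure X) :=
  fun r μ ν => (moduleOp_eq_ofReal_smul r μ.measure ν.measure).symm

theorem isBarycentricAlgebra (hp : 1 ≤ p) : IsBarycentricAlgebra (convexComb (X := X) hp) :=
  IsBarycentricAlgebra.moduleOp.of_injective (fun _ _ => WassersteinSpace.ext) (isAffine_measure hp)

variable [BorelSpace X] [CompleteSpace X]

theorem isWassersteinAlgebra (hp : 1 ≤ p) :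
    @IsWassersteinAlgebra p (WassersteinSpace p X) (emetricSpace hp) (convexComb hp) := by
  let _ : EMetricSpace (WassersteinSpace p X) := emetricSpace hp
  have hp0 : 0 < p := by linarith
  have hsum (r : I) : ENNReal.ofReal (r : ℝ) + ENNReal.ofReal (1 - (r : ℝ)) = 1 := by
    rw [← ENNReal.ofReal_add r.2.1 (sub_nonneg.2 r.2.2), add_sub_cancel, ENNReal.ofReal_one]
  have hconvex (r : I) (μ μ' ν ν' : WassersteinSpace p X) :
      edist (convexComb hp r μ ν) (convexComb hp r μ' ν') ^ p ≤
        ENNReal.ofReal (r : ℝ) * edist μ μ' ^ p + ENNReal.ofReal (1 - (r : ℝ)) * edist ν ν' ^ p :=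
    wassersteinDist_convexComb_rpow_le hp0 _ _ _ _ (hsum r)
  refine ⟨isBarycentricAlgebra hp, fun r z z' => ?_, hconvex⟩
  rw [ENNReal.coe_one, one_mul, ← ENNReal.rpow_le_rpow_iff hp0]
  calc edist (convexComb hp r z.1 z.2) (convexComb hp r z'.1 z'.2) ^ p
      ≤ ENNReal.ofReal (r : ℝ) * edist z.1 z'.1 ^ p +
          ENNReal.ofReal (1 - (r : ℝ)) * edist z.2 z'.2 ^ p := hconvex r _ _ _ _
    _ ≤ ENNReal.ofReal (r : ℝ) * edist z z' ^ p +
          ENNReal.ofReal (1 - (r : ℝ)) * edist z z' ^ p := by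
        gcongr
        · exact le_max_left _ _
        · exact le_max_right _ _
    _ = edist z z' ^ p := by rw [← add_mul, hsum, one_mul]

theorem lipschitzWith_dirac (hp : 1 ≤ p) :
    @LipschitzWith X (WassersteinSpace p X) _ (emetricSpace hp).toPseudoEMetricSpace 1
      (dirac hp) := by
  let _ : EMetricSpace (WassersteinSpace p X) := emetricSpace hp
  intro x y
  have hp0 : 0 < p := by linarith
  have hconst := wassersteinDist_map_le_lpEdist (P := Measure.dirac ()) hp0
    (aestronglyMeasurable_const (b := x)) (aestronglyMeasurable_const (b := y))
  rw [ENNReal.coe_one, one_mul]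
  simpa [lpEdist, ENNReal.rpow_rpow_inv hp0.ne'] using! hconst

end WassersteinSpace

/-! ### Finitely supported measures -/

/-- The finite combination of Dirac masses with given weights. -/
noncomputable def discreteMeasure {Z : Type*} [MeasurableSpace Z] : (Z →₀ ℝ≥0) →ₗ[ℝ≥0] Measure Z :=
  Finsupp.linearCombination ℝ≥0 Measure.dirac

section DiscreteMeasure

variable {Z Z' : Type*} [MeasurableSpace Z] [MeasurableSpace Z']

theorem map_discreteMeasure {g : Z → Z'} (hg : Measurable g) (w : Z →₀ ℝ≥0) :
    (discreteMeasure w).map g = discreteMeasure (w.mapDomain g) := by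
  induction w using Finsupp.induction_linear with
  | zero => simp
  | add w w' hw hw' => rw [map_add, Measure.map_add _ _ hg, hw, hw', Finsupp.mapDomain_add, map_add]
  | single z c => simp [discreteMeasure, Measure.map_smul, Measure.map_dirac' hg]

variable [MeasurableSingletonClass Z]

theorem lintegral_discreteMeasure (w : Z →₀ ℝ≥0) (φ : Z → ℝ≥0∞) :
    ∫⁻ z, φ z ∂discreteMeasure w = Finsupp.linearCombination ℝ≥0 φ w := by
  induction w using Finsupp.induction_linear with
  | zero => simp
  | add w w' hw hw' => rw [map_add, lintegral_add_measure, hw, hw', map_add]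
  | single z c => simp [discreteMeasure, lintegral_smul_measure]

theorem discreteMeasure_apply_singleton (w : Z →₀ ℝ≥0) (z : Z) :
    discreteMeasure w {z} = w z := by
  rw [← lintegral_indicator_one (measurableSet_singleton z), lintegral_discreteMeasure,
    Finsupp.linearCombination_apply, Finsupp.sum, Finset.sum_eq_single z] <;>
  simp +contextual [ENNReal.smul_def]

theorem discreteMeasure_injective :
    Function.Injective (discreteMeasure : (Z →₀ ℝ≥0) →ₗ[ℝ≥0] Measure Z) := fun w w' h => by
  ext z
  simpa [discreteMeasure_apply_singleton] using DFunLike.congr_fun h {z}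

theorem ae_mem_support_discreteMeasure (w : Z →₀ ℝ≥0) :
    ∀ᵐ z ∂discreteMeasure w, z ∈ w.support := by
  change discreteMeasure w (w.support : Set Z)ᶜ = 0
  rw [← lintegral_indicator_one w.support.measurableSet.compl, lintegral_discreteMeasure]
  exact Finset.sum_eq_zero fun z hz => by simp [Finsupp.mem_support_iff.1 hz]

theorem exists_discreteMeasure_eq {γ : Measure Z} [IsProbabilityMeasure γ] {S : Finset Z}
    (hS : ∀ᵐ z ∂γ, z ∈ S) : ∃ w : StdSimplex ℝ≥0 Z, discreteMeasure w.weights = γ := by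
  have hrestrict : γ.restrict (⋃ z ∈ S, {z}) = γ :=
    Measure.restrict_eq_self_of_ae_mem (by simpa using hS)
  have hdisj : (S : Set Z).Pairwise (Function.onFun Disjoint fun z => ({z} : Set Z)) :=
    fun _ _ _ _ h => disjoint_singleton.2 h
  let w : Z →₀ ℝ≥0 := ∑ z ∈ S, Finsupp.single z (γ {z}).toNNReal
  have hw : discreteMeasure w = γ := by
    rw [Measure.restrict_biUnion_finset hdisj measurableSet_singleton,
      Measure.sum_coe_finset S fun z => γ.restrict {z}] at hrestrict
    conv_rhs => rw [← hrestrict]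
    rw [map_sum]
    refine Finset.sum_congr rfl fun z _ => ?_
    rw [discreteMeasure, Finsupp.linearCombination_single, ENNReal.smul_def,
      ENNReal.coe_toNNReal (measure_ne_top _ _), Measure.restrict_singleton]
  refine ⟨⟨w, fun _ => zero_le, ?_⟩, hw⟩
  have hone := lintegral_discreteMeasure w 1
  rw [hw, Pi.one_def, lintegral_one, measure_univ, Finsupp.linearCombination_apply] at hone
  simp only [ENNReal.smul_def, smul_eq_mul, mul_one] at hone
  rw [Finsupp.sum, ← ENNReal.ofNNReal_finsetSum] at hone
  exact_mod_cast hone.symm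

end DiscreteMeasure

/-! ### Finitely supported measures are dense -/

section Dense

variable {Ω X : Type*} [MeasurableSpace Ω] [MetricSpace X] [MeasurableSpace X] [BorelSpace X]
  {p : ℝ} {P : Measure Ω}

theorem exists_simpleFunc_lpEdist_lt (hp : 0 < p) {f : Ω → X} (hf : AEStronglyMeasurable f P)
    {x₀ : X} (hx₀ : lpEdist p P (fun _ => x₀) f < ∞) {ε : ℝ≥0∞} (hε : 0 < ε) :
    ∃ g : SimpleFunc Ω X, lpEdist p P f g < ε := by
  let f' : Ω → X := hf.mk f
  have hf' : Measurable f' := hf.stronglyMeasurable_mk.measurable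
  let S : Set X := insert x₀ (range f')
  have hx₀S : x₀ ∈ S := mem_insert x₀ _
  have hsep : TopologicalSpace.SeparableSpace S := ((finite_singleton x₀).isSeparable.union
    hf.stronglyMeasurable_mk.isSeparable_range).separableSpace
  let g (n : ℕ) : SimpleFunc Ω X := SimpleFunc.approxOn f' hf' S x₀ hx₀S n
  have hdist : Filter.Tendsto (fun n => ∫⁻ ω, edist (f ω) (g n ω) ^ p ∂P) Filter.atTop
      (nhds (∫⁻ _, 0 ∂P)) := by
    refine tendsto_lintegral_of_dominated_convergence' (fun ω => edist x₀ (f ω) ^ p)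
      (fun n => (hf.edist (g n).aestronglyMeasurable).pow_const p) (fun n => ?_) ?_ ?_
    · filter_upwards [hf.ae_eq_mk] with ω hω
      gcongr
      rw [hω, edist_comm]
      exact SimpleFunc.edist_approxOn_le hf' hx₀S ω n
    · rw [lpEdist_lt_iff hp, ENNReal.top_rpow_of_pos hp] at hx₀
      exact hx₀.ne
    · filter_upwards [hf.ae_eq_mk] with ω hω
      have htendsto : Filter.Tendsto (fun n => g n ω) Filter.atTop (nhds (f' ω)) :=
        SimpleFunc.tendsto_approxOn hf' hx₀S
          (subset_closure (mem_insert_of_mem _ (mem_range_self ω)))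
      rw [hω]
      simpa [f', hp] using (tendsto_const_nhds (x := f' ω)).edist htendsto |>.ennrpow_const p
  rw [lintegral_zero] at hdist
  obtain ⟨n, hn⟩ := (hdist.eventually_lt_const (ENNReal.rpow_pos_of_nonneg hε hp.le)).exists
  exact ⟨g n, (lpEdist_lt_iff hp).2 hn⟩

theorem exists_wassersteinDist_discreteMeasure_lt (hp : 0 < p) {μ : Measure X}
    [IsProbabilityMeasure μ] [μ.InnerRegular] (hμ : HasFiniteMoment p μ) {ε : ℝ≥0∞} (hε : 0 < ε) :
    ∃ w : StdSimplex ℝ≥0 X, wassersteinDist p μ (discreteMeasure w.weights) < ε := by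
  have hid := aestronglyMeasurable_id_of_innerRegular μ
  rw [← Measure.map_id (μ := μ), hasFiniteMoment_map_iff hp aemeasurable_id] at hμ
  obtain ⟨x₀, hx₀⟩ := hμ
  obtain ⟨g, hg⟩ := exists_simpleFunc_lpEdist_lt hp hid hx₀ hε
  have : IsProbabilityMeasure (μ.map g) :=
    Measure.isProbabilityMeasure_map g.measurable.aemeasurable
  have hrange : ∀ᵐ x ∂μ.map g, x ∈ g.range :=
    (ae_map_iff g.measurable.aemeasurable g.range.measurableSet).2
      (ae_of_all _ g.mem_range_self)
  obtain ⟨w, hw⟩ := exists_discreteMeasure_eq hrange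
  refine ⟨w, lt_of_le_of_lt ?_ hg⟩
  simpa only [Measure.map_id, hw] using
    wassersteinDist_map_le_lpEdist hp hid g.aestronglyMeasurable

namespace WassersteinSpace

theorem measure_barycenter_dirac (hp : 1 ≤ p) (w : StdSimplex ℝ≥0 X) :
    (barycenter (isBarycentricAlgebra hp) w (dirac hp)).measure = discreteMeasure w.weights :=
  (isAffine_measure hp).map_barycenter_eq_linearCombination _ w (dirac hp)

theorem denseRange_barycenter_dirac [CompleteSpace X] (hp : 1 ≤ p) :
    @DenseRange _ (emetricSpace hp).toUniformSpace.toTopologicalSpace _ fun w =>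
      barycenter (isBarycentricAlgebra (X := X) hp) w (dirac hp) := by
  let _ : EMetricSpace (WassersteinSpace p X) := emetricSpace hp
  refine fun μ => EMetric.mem_closure_iff.2 fun ε hε => ?_
  obtain ⟨w, hw⟩ := exists_wassersteinDist_discreteMeasure_lt (by linarith) μ.hasFiniteMoment hε
  exact ⟨_, ⟨w, rfl⟩, by rwa [← measure_barycenter_dirac hp] at hw⟩

end WassersteinSpace

end Dense

/-! ### The universal property -/

section Universal

theorem exists_lipschitzWith_extension {S A B : Type*} [PseudoEMetricSpace A] [EMetricSpace B]
    [CompleteSpace B] {j : S → A} (hj : DenseRange j) {f : S → B}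
    (hf : ∀ s t, edist (f s) (f t) ≤ edist (j s) (j t)) :
    ∃ h : A → B, LipschitzWith 1 h ∧ ∀ s, h (j s) = f s := by
  let g : range j → B := f ∘ rangeSplitting j
  have hg : LipschitzWith 1 g := fun a b => by
    simpa [g, apply_rangeSplitting, Subtype.edist_eq] using
      hf (rangeSplitting j a) (rangeSplitting j b)
  refine ⟨hj.extend g, hj.lipschitzWith_extend hg, fun s => ?_⟩
  rw [Dense.extend_eq hj hg.continuous ⟨j s, mem_range_self s⟩, ← edist_le_zero]
  simpa [g, apply_rangeSplitting] using hf (rangeSplitting j ⟨j s, mem_range_self s⟩) s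

/-- Jensen's inequality for the `p`-th power of the distance, a function on the square of the
algebra. -/
theorem edist_barycenter_rpow_le {A X : Type*} [EMetricSpace A] {op : I → A → A → A} {p : ℝ}
    (h : IsWassersteinAlgebra p op) (w : StdSimplex ℝ≥0 X) (f g : X → A) :
    edist (barycenter h.toIsBarycentricAlgebra w f) (barycenter h.toIsBarycentricAlgebra w g) ^ p ≤
      Finsupp.linearCombination ℝ≥0 (fun x => edist (f x) (g x) ^ p) w.weights := by
  have hjensen := map_barycenter_le_linearCombination
    (h.toIsBarycentricAlgebra.prod h.toIsBarycentricAlgebra) (φ := fun z => edist z.1 z.2 ^ p)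
    (fun r z z' => ?_) w fun x => (f x, g x)
  · rwa [barycenter_prod] at hjensen
  · rw [moduleOp_eq_ofReal_smul]
    exact h.edist_op_rpow_le r _ _ _ _

theorem IsCoupling.exists_map_fst_eq_map_snd_eq {X : Type*} [MetricSpace X] [MeasurableSpace X]
    [BorelSpace X] {w w' : StdSimplex ℝ≥0 X} {γ : @Measure (X × X) (borel (X × X))}
    (hγ : IsCoupling (discreteMeasure w.weights) (discreteMeasure w'.weights) γ) :
    ∃ v : StdSimplex ℝ≥0 (X × X), @discreteMeasure _ (borel (X × X)) v.weights = γ ∧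
      v.map Prod.fst = w ∧ v.map Prod.snd = w' := by
  let : MeasurableSpace (X × X) := borel (X × X)
  have : BorelSpace (X × X) := ⟨rfl⟩
  have hfst : Measurable (Prod.fst : X × X → X) := continuous_fst.measurable
  have hsnd : Measurable (Prod.snd : X × X → X) := continuous_snd.measurable
  have := hγ.isProbabilityMeasure
  have hsupp : ∀ᵐ z ∂γ, z ∈ w.weights.support ×ˢ w'.weights.support := by
    have hw := ae_mem_support_discreteMeasure w.weights
    have hw' := ae_mem_support_discreteMeasure w'.weights
    rw [← hγ.map_fst] at hw
    rw [← hγ.map_snd] at hw'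
    filter_upwards [ae_of_ae_map hfst.aemeasurable hw, ae_of_ae_map hsnd.aemeasurable hw']
      with z hz hz' using Finset.mem_product.2 ⟨hz, hz'⟩
  obtain ⟨v, rfl⟩ := exists_discreteMeasure_eq hsupp
  refine ⟨v, rfl, ?_, ?_⟩
  · refine StdSimplex.ext (discreteMeasure_injective ?_)
    rw [StdSimplex.weights_map, ← map_discreteMeasure hfst, hγ.map_fst]
  · refine StdSimplex.ext (discreteMeasure_injective ?_)
    rw [StdSimplex.weights_map, ← map_discreteMeasure hsnd, hγ.map_snd]

/-- Couplings of finitely supported measures are finitely supported, so the Wasserstein inequality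
extends from binary to finite barycenters. -/
theorem edist_barycenter_le_wassersteinDist {B X : Type*} [EMetricSpace B] {op : I → B → B → B}
    {p : ℝ} [MetricSpace X] [MeasurableSpace X] [BorelSpace X] (hp : 0 < p)
    (hB : IsWassersteinAlgebra p op) {f : X → B} (hf : LipschitzWith 1 f)
    (w w' : StdSimplex ℝ≥0 X) :
    edist (barycenter hB.toIsBarycentricAlgebra w f)
        (barycenter hB.toIsBarycentricAlgebra w' f) ≤
      wassersteinDist p (discreteMeasure w.weights) (discreteMeasure w'.weights) := by
  rw [← ENNReal.rpow_le_rpow_iff hp, wassersteinDist_rpow hp]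
  refine le_iInf₂ fun γ hγ => ?_
  let : MeasurableSpace (X × X) := borel (X × X)
  have : BorelSpace (X × X) := ⟨rfl⟩
  obtain ⟨v, rfl, rfl, rfl⟩ := hγ.exists_map_fst_eq_map_snd_eq
  rw [barycenter_map, barycenter_map, transportCost, lintegral_discreteMeasure]
  refine (edist_barycenter_rpow_le hB v _ _).trans ?_
  refine Finset.sum_le_sum fun z _ => ?_
  exact smul_le_smul_of_nonneg_left
    (ENNReal.rpow_le_rpow (by simpa using hf z.1 z.2) hp.le) zero_le

namespace WassersteinSpace

variable {X B : Type*} [MetricSpace X] [MeasurableSpace X] [BorelSpace X] [CompleteSpace X]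
  [EMetricSpace B] {p : ℝ} {op : I → B → B → B}

theorem isAffine_of_map_barycenter_dirac (hp : 1 ≤ p) (hB : IsWassersteinAlgebra p op)
    {f : X → B} {h : WassersteinSpace p X → B}
    (hcont : @Continuous _ _ (emetricSpace hp).toUniformSpace.toTopologicalSpace _ h)
    (hbary : ∀ w, h (barycenter (isBarycentricAlgebra hp) w (dirac hp)) =
      barycenter hB.toIsBarycentricAlgebra w f) : IsAffine (convexComb hp) op h := by
  let _ : EMetricSpace (WassersteinSpace p X) := emetricSpace hp
  intro r μ ν
  have hcombA : Continuous fun z : WassersteinSpace p X × WassersteinSpace p X =>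
    convexComb hp r z.1 z.2 := ((isWassersteinAlgebra hp).nonexpansive r).continuous
  have hcombB : Continuous fun z : B × B => op r z.1 z.2 := (hB.nonexpansive r).continuous
  refine (denseRange_barycenter_dirac hp).induction_on₂
    (p := fun μ ν => h (convexComb hp r μ ν) = op r (h μ) (h ν))
    (isClosed_eq (by fun_prop) (by fun_prop)) (fun w w' => ?_) μ ν
  have hw : barycenter (isBarycentricAlgebra hp) (stdSimplexOp r w w') (dirac hp) =
    convexComb hp r _ _ := isAffine_barycenter _ _ r w w'
  rw [← hw, hbary, hbary, hbary]
  exact isAffine_barycenter _ f r w w'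

theorem existsUnique_extension [CompleteSpace B] (hp : 1 ≤ p) (hB : IsWassersteinAlgebra p op)
    {f : X → B} (hf : LipschitzWith 1 f) :
    ∃! h : WassersteinSpace p X → B,
      @IsWassersteinHom _ _ (emetricSpace hp) _ (convexComb hp) op h ∧
        ∀ x, h (dirac hp x) = f x := by
  let _ : EMetricSpace (WassersteinSpace p X) := emetricSpace hp
  have hdense : DenseRange fun w => barycenter (isBarycentricAlgebra (X := X) hp) w (dirac hp) :=
    denseRange_barycenter_dirac hp
  obtain ⟨h, hlip, hbary⟩ := exists_lipschitzWith_extension hdense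
    (f := fun w => barycenter hB.toIsBarycentricAlgebra w f) fun w w' => by
      refine (edist_barycenter_le_wassersteinDist (by linarith) hB hf w w').trans_eq ?_
      rw [← measure_barycenter_dirac hp, ← measure_barycenter_dirac hp]
      rfl
  refine ⟨h, ⟨⟨hlip, isAffine_of_map_barycenter_dirac hp hB hlip.continuous hbary⟩,
    fun x => ?_⟩, fun k ⟨hk, hkdirac⟩ => ?_⟩
  · have hsingle := hbary (StdSimplex.single x)
    rwa [barycenter_single, barycenter_single] at hsingle
  · refine hdense.equalizer hk.nonexpansive.continuous hlip.continuous (funext fun w => ?_)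
    have hkbary := IsAffine.map_barycenter (g := k) hk.map_op (isBarycentricAlgebra hp)
      hB.toIsBarycentricAlgebra w (dirac hp)
    rwa [show k ∘ dirac hp = f from funext hkdirac, ← hbary] at hkbary

end WassersteinSpace

end Universal

theorem mainTheorem8 (p : ℝ) (hp : 1 ≤ p) (X : Type u) [MetricSpace X] [CompleteSpace X]
    [MeasurableSpace X] [BorelSpace X] :
    ∃ _ : EMetricSpace (WassersteinSpace p X),
      (∀ μ ν : WassersteinSpace p X, edist μ ν = wassersteinDist p μ.measure ν.measure) ∧
      IsFreeCompleteWassersteinAlgebra.{u, u, v} p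
        (WassersteinSpace.convexComb (X := X) hp) (WassersteinSpace.dirac hp) := by
  refine ⟨WassersteinSpace.emetricSpace hp, fun _ _ => rfl, ?_⟩
  exact @IsFreeCompleteWassersteinAlgebra.mk p X _ _ (WassersteinSpace.emetricSpace hp) _ _
    (WassersteinSpace.completeSpace hp) (WassersteinSpace.isWassersteinAlgebra hp)
    (WassersteinSpace.lipschitzWith_dirac hp)
    fun _ _ _ _ hB _ hf => WassersteinSpace.existsUnique_extension hp hB hf
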